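/- Let $d\ge 4$ be an integer and let $\Lambda\subseteq\mathbb N=\{0,1,2,\dots\}$. For $\lambda\in\mathbb N$, $f:\mathbb Z^d\to\mathbb C$ and $x\in\mathbb Z^d$ put \[ A_\lambda f(x)=\frac{1}{\#\{y\in\mathbb Z^d:|y|^2=\lambda\}}\sum_{y\in\mathbb Z^d:\,|y|^2=\lambda} f(x-y), \qquad M_\Lambda f(x)=\sup_{\lambda\in\Lambda}|A_\lambda f(x)| , \] where $|y|^2=y_1^2+\dots+y_d^2$ (and $M_\emptyset f=0$). For a prime $q$ let $\delta_q(\Lambda)$ be the $q$-adic upper Minkowski dimension of $\Lambda$, that is \[ \delta_q(\Lambda)=\limsup_{\varepsilon\to0^+}\frac{\log N_q(\Lambda,\varepsilon)}{\log(1/\varepsilon)}, \] where $N_q(\Lambda,\varepsilon)$ is the least number of closed balls of radius $\varepsilon$ in the $q$-adic integers $\mathbb Z_q$, centred at points of $\Lambda$, that cover $\Lambda$ (with $\delta_q(\emptyset)=0$). Let $\delta_\infty(\Lambda)$ be the infimum of all $\delta\ge0$ for which there is a constant $C_\delta$ with $\#(\Lambda\cap[N,2N])\le C_\delta N^{\delta}$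 for all integers $N\ge1$. Define \[ \eta(\Lambda)=\max\Big\{\sup_{q\text{ prime}}\Big(1+\frac{\delta_q(\Lambda)}{d-1}\Big),\ 1+\frac{2\,\delta_\infty(\Lambda)}{d-2}\Big\}. \] Then for every real $p$ with $1\le p<\eta(\Lambda)$, and, if $\Lambda$ is infinite, for every real $p$ with $0<p<\eta(\Lambda)$, the operator $M_\Lambda$ is unbounded on $\ell^p(\mathbb Z^d)$: there is no finite constant $C$ such that $\|M_\Lambda f\|_{\ell^p(\mathbb Z^d)}\le C\|f\|_{\ell^p(\mathbb Z^d)}$ for all $f\in\ell^p(\mathbb Z^d)$. -/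

import Mathlib

open Filter Topology
open scoped ENNReal NNReal

noncomputable section

namespace ArithSphere

/-- The lattice points `y ∈ ℤ^d` with `|y|² = n`. -/
def sphere (d n : ℕ) : Set (Fin d → ℤ) :=
  {y | ∑ i, y i ^ 2 = (n : ℤ)}

theorem sphere_finite (d n : ℕ) : (sphere d n).Finite := by
  refine (Set.finite_Icc (fun _ : Fin d => -(n : ℤ)) (fun _ => (n : ℤ))).subset ?_
  intro y hy
  have hy' : ∑ i, y i ^ 2 = (n : ℤ) := hy
  have h : ∀ i, y i ^ 2 ≤ (n : ℤ) := fun i =>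
    hy' ▸ Finset.single_le_sum (fun j _ => sq_nonneg (y j)) (Finset.mem_univ i)
  refine ⟨fun i => ?_, fun i => ?_⟩
  · have := h i
    have h2 := Int.le_self_sq (-(y i))
    show -(n : ℤ) ≤ y i
    nlinarith
  · exact (Int.le_self_sq (y i)).trans (h i)

/-- The arithmetic spherical average
`A_n f(x) = #{y ∈ ℤ^d : |y|² = n}⁻¹ ∑_{|y|² = n} f(x - y)`. -/
def avg {d : ℕ} (n : ℕ) (f : (Fin d → ℤ) → ℂ) (x : Fin d → ℤ) : ℂ :=
  (∑ y ∈ (sphere_finite d n).toFinset, f (x - y)) / ((sphere d n).ncard : ℂ)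

/-- The arithmetic spherical maximal function `M_Λ f(x) = sup_{n ∈ Λ} |A_n f(x)|`,
as a function with values in `[0, ∞]`. -/
def maximalFn {d : ℕ} (Λ : Set ℕ) (f : (Fin d → ℤ) → ℂ) (x : Fin d → ℤ) : ℝ≥0∞ :=
  ⨆ n ∈ Λ, ‖avg n f x‖ₑ

/-- The `ℓ^p(ℤ^d)` norm of a `[0, ∞]`-valued function, for `0 < p < ∞`. -/
def ellNorm {d : ℕ} (p : ℝ) (g : (Fin d → ℤ) → ℝ≥0∞) : ℝ≥0∞ :=
  (∑' x, g x ^ p) ^ (1 / p)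

/-- `M_Λ` is bounded on `ℓ^p(ℤ^d)`: there is a finite `C` with
`‖M_Λ f‖_p ≤ C ‖f‖_p` for all `f ∈ ℓ^p(ℤ^d)`. -/
def IsBoundedMaximal (d : ℕ) (Λ : Set ℕ) (p : ℝ) : Prop :=
  ∃ C : ℝ≥0, ∀ f : (Fin d → ℤ) → ℂ, Memℓp f (ENNReal.ofReal p) →
    ellNorm p (maximalFn Λ f) ≤ C * ellNorm p (fun x => ‖f x‖ₑ)

/-- The `q`-adic upper Minkowski dimension of `Λ`, i.e. `limsup_{ε → 0+} log N(ε) / log (1/ε)`,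
where `N(ε)` is the least number of closed balls of radius `ε` (centred in `Λ`) that cover `Λ`
in `ℤ_q`. Since `ℤ_q` is compact, `N(ε)` is finite. The empty set gets dimension `0`. -/
def padicDim (q : ℕ) [Fact q.Prime] (Λ : Set ℕ) : ℝ :=
  limsup (fun ε : ℝ≥0 =>
    Real.log (Metric.coveringNumber ε ((fun n : ℕ => (n : ℤ_[q])) '' Λ)).toNat
      / Real.log (1 / (ε : ℝ))) (𝓝[>] 0)

/-- The infimum of the `δ ≥ 0` such that `#(Λ ∩ [N, 2N]) ≤ C N^δ` for all `N ≥ 1`,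
with `C` independent of `N`. -/
def growthExp (Λ : Set ℕ) : ℝ :=
  sInf {δ : ℝ | 0 ≤ δ ∧ ∃ C : ℝ, ∀ N : ℕ, 1 ≤ N →
    ((Λ ∩ Set.Icc N (2 * N)).ncard : ℝ) ≤ C * (N : ℝ) ^ δ}

/-- `η(Λ) = max { sup_q (1 + δ_q(Λ) / (d - 1)), 1 + 2 δ_∞(Λ) / (d - 2) }`. -/
def eta (d : ℕ) (Λ : Set ℕ) : ℝ :=
  max (⨆ q : Nat.Primes,
      (1 + (haveI : Fact (q : ℕ).Prime := ⟨q.2⟩; padicDim (q : ℕ) Λ) / ((d : ℝ) - 1)))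
    (1 + 2 * growthExp Λ / ((d : ℝ) - 2))

end ArithSphere

end

namespace ArithSphere

/-! Boundedness on `ℓ^p` with `p ≥ 1` is tested on two families of functions. A point mass at the
origin makes the maximal function at least `1 / r(n)` on the whole sphere of each `n ∈ Λ`, where
`r(n)` counts its lattice points. Hence the sum of `r(n)^(1-p)` over `Λ` is finite, and `r(n) ≲
n^(d/2-1+ε)` gives `δ_∞ ≤ (p-1)(d-2)/2`. The indicator of a large piece of `Qℤ^d` has averages
equal, well inside the piece, to the proportion of the sphere in a given residue class mod `Q`.
These proportions sum to 1 over the at most `K` residues `r` with `|r|² = n`, so their `p`-th powers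
sum to at least `K^(1-p)`. Different residues of `n` use disjoint sets of `r`, so `Λ` meets `≲
K^(p-1)` classes mod `Q`. With `Q = q^k` and `K ≲ Q^(d-1+ε)` this is `δ_q ≤ (p-1)(d-1)`. Only upper
bounds on point counts are needed, and both come from the divisor bound in `ℤ[i]`. For `p ≤ 1` and
`Λ` infinite, the point-mass sum diverges because each term is at least 1. -/

/-! ### The divisor bound in the Gaussian integers and sums of two squares. -/

theorem exists_add_one_le_mul_two_rpow {ε : ℝ} (hε : 0 < ε) :
    ∃ K : ℝ, 1 ≤ K ∧ ∀ a : ℕ, (a : ℝ) + 1 ≤ K * (2 : ℝ) ^ (ε * a) := by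
  have hl : 0 < Real.log 2 := Real.log_pos one_lt_two
  refine ⟨1 + 1 / (ε * Real.log 2), by simp; positivity, fun a => ?_⟩
  have h1 : ε * Real.log 2 * a + 1 ≤ (2 : ℝ) ^ (ε * a) := by
    rw [Real.rpow_def_of_pos two_pos]
    convert Real.add_one_le_exp (Real.log 2 * (ε * a)) using 2
    ring
  calc (a : ℝ) + 1 ≤ (1 + 1 / (ε * Real.log 2)) * (ε * Real.log 2 * a + 1) := by
        have : (1 + 1 / (ε * Real.log 2)) * (ε * Real.log 2 * a + 1)
          = a + 1 + (ε * Real.log 2 * a + 1 / (ε * Real.log 2)) := by field_simp; ring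
        rw [this]
        have : 0 ≤ ε * Real.log 2 * a + 1 / (ε * Real.log 2) := by positivity
        linarith
    _ ≤ _ := by gcongr

/-- The number of sub-multisets of `s` is at most a small power of the product of the weights
of the elements of `s`, if only finitely many weights are small. -/
theorem prod_count_add_one_le {α : Type*} [DecidableEq α] {ε K : ℝ} (hε : 0 < ε) (hK1 : 1 ≤ K)
    (hK : ∀ a : ℕ, (a : ℝ) + 1 ≤ K * (2 : ℝ) ^ (ε * a)) (w : α → ℝ) (B : Finset α)
    (s : Multiset α) (hw : ∀ x ∈ s, 2 ≤ w x) (hB : ∀ x ∈ s, x ∉ B → 2 ≤ w x ^ ε) :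
    ∏ x ∈ s.toFinset, ((s.count x : ℝ) + 1) ≤ K ^ B.card * (s.map w).prod ^ ε := by
  have hw0 : ∀ x ∈ s.toFinset, 0 ≤ w x := fun x hx => by
    linarith [hw x (Multiset.mem_toFinset.1 hx)]
  rw [Finset.prod_multiset_map_count, ← Real.finsetProd_rpow _ _ (fun x hx => pow_nonneg (hw0 x hx) _)]
  calc ∏ x ∈ s.toFinset, ((s.count x : ℝ) + 1)
      ≤ ∏ x ∈ s.toFinset, ((if x ∈ B then K else 1) * (w x ^ s.count x) ^ ε) := by
        refine Finset.prod_le_prod (fun _ _ => by positivity) fun x hx => ?_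
        have hx' := Multiset.mem_toFinset.1 hx
        have h0 := hw0 x hx
        have e : (w x ^ s.count x) ^ ε = w x ^ (ε * (s.count x : ℝ)) := by
          rw [← Real.rpow_natCast, ← Real.rpow_mul h0, mul_comm]
        rw [e]
        -- Each small weight costs one factor `K`; for a large weight, `a + 1 ≤ 2^a ≤ (w^ε)^a` costs
        -- nothing.
        split_ifs with hxB
        · refine (hK _).trans ?_
          gcongr
          exact hw x hx'
        · rw [one_mul, Real.rpow_mul h0, Real.rpow_natCast]
          calc ((s.count x : ℝ) + 1) ≤ 2 ^ s.count x := by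
                exact_mod_cast Nat.lt_two_pow_self
            _ ≤ _ := by
              gcongr
              exact hB x hx' hxB
    _ = (∏ x ∈ s.toFinset, (if x ∈ B then K else 1)) * _ := Finset.prod_mul_distrib
    _ ≤ _ := by
        gcongr
        · exact Finset.prod_nonneg fun x hx => by have := hw0 x hx; positivity
        · rw [← Finset.prod_filter, Finset.prod_const]
          refine pow_le_pow_right₀ hK1 (Finset.card_le_card fun x hx => ?_)
          exact (Finset.mem_filter.1 hx).2

theorem finite_setOf_norm_le (b : ℤ) : {z : GaussianInt | z.norm ≤ b}.Finite := by
  have h : ((Set.Icc (-b) b ×ˢ Set.Icc (-b) b).image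
      fun t : ℤ × ℤ => (⟨t.1, t.2⟩ : GaussianInt)).Finite :=
    ((Set.finite_Icc _ _).prod (Set.finite_Icc _ _)).image _
  refine h.subset fun z hz => ⟨(z.re, z.im), ?_, rfl⟩
  have hz : z.norm ≤ b := hz
  rw [Zsqrtd.norm_def] at hz
  have h1 := Int.le_self_sq z.re
  have h2 := Int.le_self_sq (-z.re)
  have h3 := Int.le_self_sq z.im
  have h4 := Int.le_self_sq (-z.im)
  simp only [Set.mem_prod, Set.mem_Icc]
  refine ⟨⟨?_, ?_⟩, ?_, ?_⟩ <;> nlinarith [sq_nonneg z.re, sq_nonneg z.im]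

theorem finite_units_gaussianInt : Finite GaussianIntˣ := by
  have : Finite {z : GaussianInt | z.norm ≤ 1} := (finite_setOf_norm_le 1)
  refine Finite.of_injective
    (fun u : GaussianIntˣ => (⟨(u : GaussianInt), ?_⟩ : {z : GaussianInt | z.norm ≤ 1})) ?_
  · have := (Zsqrtd.norm_eq_one_iff' (by norm_num) (u : GaussianInt)).2 u.isUnit
    exact this.le
  · intro u v h
    exact Units.ext (congrArg Subtype.val h)

/-- The divisor bound in the ring of Gaussian integers. -/
theorem exists_card_divisors_gaussianInt_le {ε : ℝ} (hε : 0 < ε) :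
    ∃ C : ℝ, 0 ≤ C ∧ ∀ m : GaussianInt, m ≠ 0 → ∀ S : Finset GaussianInt, (∀ z ∈ S, z ∣ m) →
      (S.card : ℝ) ≤ C * (m.norm : ℝ) ^ ε := by
  classical
  obtain ⟨K, hK1, hK⟩ := exists_add_one_le_mul_two_rpow hε
  let _ : StrongNormalizationMonoid GaussianInt :=
    UniqueFactorizationMonoid.strongNormalizationMonoid
  have := finite_units_gaussianInt
  -- Outside `B` the norm exceeds `2^(1/ε)`, so its `ε`-th power is at least 2.
  let B : Finset GaussianInt := (finite_setOf_norm_le ⌈(2 : ℝ) ^ (1 / ε)⌉).toFinset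
  refine ⟨Nat.card GaussianIntˣ * K ^ B.card, by positivity, fun m hm S hS => ?_⟩
  let s := UniqueFactorizationMonoid.normalizedFactors m
  -- Up to a unit, a divisor of `m` is determined by its prime factors, a sub-multiset of those of
  -- `m`.
  have hcard : S.card ≤ Nat.card GaussianIntˣ * (Finset.Iic s).card := by
    refine (Finset.card_le_mul_card_image (f := UniqueFactorizationMonoid.normalizedFactors) S
      (Nat.card GaussianIntˣ) ?_).trans (Nat.mul_le_mul_left _ (Finset.card_le_card ?_))
    · intro t ht
      obtain ⟨z₀, hz₀, rfl⟩ := Finset.mem_image.1 ht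
      have hz0 : z₀ ≠ 0 := ne_zero_of_dvd_ne_zero hm (hS _ hz₀)
      have := Fintype.ofFinite GaussianIntˣ
      rw [Nat.card_eq_fintype_card, ← Finset.card_univ]
      refine (Finset.card_le_card ?_).trans
        (Finset.card_image_le (f := fun u : GaussianIntˣ => z₀ * (u : GaussianInt)))
      intro z hz
      rw [Finset.mem_filter] at hz
      have hz1 : z ≠ 0 := ne_zero_of_dvd_ne_zero hm (hS _ hz.1)
      obtain ⟨u, hu⟩ :=
        (UniqueFactorizationMonoid.associated_iff_normalizedFactors_eq_normalizedFactors
          hz0 hz1).2 hz.2.symm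
      exact Finset.mem_image.2 ⟨u, Finset.mem_univ _, hu⟩
    · intro t ht
      obtain ⟨z, hz, rfl⟩ := Finset.mem_image.1 ht
      have hz0 : z ≠ 0 := ne_zero_of_dvd_ne_zero hm (hS _ hz)
      exact Finset.mem_Iic.2
        ((UniqueFactorizationMonoid.dvd_iff_normalizedFactors_le_normalizedFactors hz0 hm).1 (hS z hz))
  have hnorm : (s.map fun z => (z.norm : ℝ)).prod = (m.norm : ℝ) := by
    have h1 : (s.map fun z => (z.norm : ℝ)).prod = ((s.prod.norm : ℤ) : ℝ) := by
      have := (Multiset.prod_hom s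
        (((Int.castRingHom ℝ).toMonoidHom).comp (Zsqrtd.normMonoidHom (d := -1))))
      exact this
    rw [h1, Zsqrtd.norm_eq_of_associated (by norm_num)
      (UniqueFactorizationMonoid.prod_normalizedFactors hm)]
  have hnorm2 : ∀ z ∈ s, 2 ≤ z.norm := by
    intro z hz
    have hp := UniqueFactorizationMonoid.prime_of_normalized_factor z hz
    have h0 := GaussianInt.norm_pos.2 hp.ne_zero
    have h1 : z.norm ≠ 1 := fun h =>
      hp.not_isUnit ((Zsqrtd.norm_eq_one_iff' (by norm_num) z).1 h)
    omega
  have key := prod_count_add_one_le hε hK1 hK (fun z : GaussianInt => (z.norm : ℝ)) B s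
    (fun z hz => by exact_mod_cast hnorm2 z hz) (fun z hz hzB => by
      have h1 : (2 : ℝ) ^ (1 / ε) ≤ z.norm := by
        have h2 : ¬ z.norm ≤ ⌈(2 : ℝ) ^ (1 / ε)⌉ := fun h => hzB (by simpa [B] using h)
        exact (Int.le_ceil _).trans (by exact_mod_cast (not_le.1 h2).le)
      calc (2 : ℝ) = ((2 : ℝ) ^ (1 / ε)) ^ ε := by
            rw [← Real.rpow_mul two_pos.le, one_div_mul_cancel hε.ne', Real.rpow_one]
        _ ≤ _ := by gcongr)
  rw [hnorm] at key
  calc (S.card : ℝ) ≤ Nat.card GaussianIntˣ * (Finset.Iic s).card := by exact_mod_cast hcard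
    _ = Nat.card GaussianIntˣ * ∏ x ∈ s.toFinset, ((s.count x : ℝ) + 1) := by
        rw [Multiset.card_Iic]; push_cast; rfl
    _ ≤ Nat.card GaussianIntˣ * (K ^ B.card * (m.norm : ℝ) ^ ε) := by gcongr
    _ = _ := by ring

/-- An integer has few representations as a sum of two squares. -/
theorem exists_card_sq_add_sq_le {ε : ℝ} (hε : 0 < ε) :
    ∃ C : ℝ, 1 ≤ C ∧ ∀ n : ℕ, 1 ≤ n → ∀ m : ℤ, m ≤ n → ∀ S : Finset (ℤ × ℤ),
      (∀ z ∈ S, z.1 ^ 2 + z.2 ^ 2 = m) → (S.card : ℝ) ≤ C * (n : ℝ) ^ ε := by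
  classical
  -- The exponent is halved because the rational integer `m` has Gaussian norm `m²`.
  obtain ⟨C, hC0, hC⟩ := exists_card_divisors_gaussianInt_le (half_pos hε)
  refine ⟨C + 1, by linarith, fun n hn m hmn S hS => ?_⟩
  have hn1 : (1 : ℝ) ≤ (n : ℝ) ^ ε := Real.one_le_rpow (by exact_mod_cast hn) hε.le
  rcases lt_trichotomy m 0 with hm | rfl | hm
  · have : S = ∅ := Finset.eq_empty_of_forall_notMem fun z hz => by
      have := hS z hz
      nlinarith [sq_nonneg z.1, sq_nonneg z.2]
    subst this
    simp only [Finset.card_empty, Nat.cast_zero]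
    positivity
  · have : S ⊆ {(0, 0)} := fun z hz => by
      have := hS z hz
      have h1 : z.1 = 0 := by nlinarith [sq_nonneg z.1, sq_nonneg z.2]
      have h2 : z.2 = 0 := by nlinarith [sq_nonneg z.1, sq_nonneg z.2]
      simp [Prod.ext_iff, h1, h2]
    have h1 : (S.card : ℝ) ≤ 1 := by exact_mod_cast (Finset.card_le_card this)
    nlinarith
  · have h := hC (m : GaussianInt) (by exact_mod_cast hm.ne')
      (S.image fun t => (⟨t.1, t.2⟩ : GaussianInt)) (by
        intro z hz
        obtain ⟨t, ht, rfl⟩ := Finset.mem_image.1 hz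
        have : (m : GaussianInt) = (⟨t.1, t.2⟩ : GaussianInt) * star (⟨t.1, t.2⟩ : GaussianInt) := by
          rw [← Zsqrtd.norm_eq_mul_conj, Zsqrtd.norm_def, ← hS t ht]
          congr 1
          ring
        exact ⟨_, this⟩)
    rw [Finset.card_image_of_injective _ (fun a b hab => by
      simpa [Zsqrtd.ext_iff, Prod.ext_iff] using hab)] at h
    have hm0 : (0 : ℝ) < m := by exact_mod_cast hm
    have e : (((m : GaussianInt).norm : ℤ) : ℝ) ^ (ε / 2) = (m : ℝ) ^ ε := by
      rw [Zsqrtd.norm_intCast]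
      push_cast
      rw [← sq, ← Real.rpow_natCast, ← Real.rpow_mul hm0.le]
      congr 1
      push_cast
      ring
    rw [e] at h
    have hmn' : (m : ℝ) ^ ε ≤ (n : ℝ) ^ ε :=
      Real.rpow_le_rpow hm0.le (by exact_mod_cast hmn) hε.le
    nlinarith

/-! ### Lattice points on spheres, over the integers and modulo `Q`. -/

theorem mem_sphere {d n : ℕ} {y : Fin d → ℤ} : y ∈ sphere d n ↔ ∑ i, y i ^ 2 = (n : ℤ) := Iff.rfl

theorem abs_le_sqrt_of_mem_sphere {d n : ℕ} {y : Fin d → ℤ} (hy : y ∈ sphere d n) (i : Fin d) :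
    |y i| ≤ Nat.sqrt n := by
  have h : y i ^ 2 ≤ (n : ℤ) :=
    (mem_sphere.1 hy) ▸ Finset.single_le_sum (fun j _ => sq_nonneg (y j)) (Finset.mem_univ i)
  have h2 : (y i).natAbs ≤ Nat.sqrt n := by
    rw [Nat.le_sqrt, ← sq]
    zify
    simpa using h
  rw [Int.abs_eq_natAbs]
  exact_mod_cast h2

/-- Upper bound for the number of representations as a sum of `e + 2` squares. -/
theorem exists_ncard_sphere_le (e : ℕ) {ε : ℝ} (hε : 0 < ε) :
    ∃ C : ℝ, 1 ≤ C ∧ ∀ n N : ℕ, 1 ≤ N → n ≤ N →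
      ((sphere (e + 2) n).ncard : ℝ) ≤ C * (N : ℝ) ^ ((e : ℝ) / 2 + ε) := by
  classical
  obtain ⟨C, hC1, hC⟩ := exists_card_sq_add_sq_le hε
  refine ⟨3 ^ e * C, one_le_mul_of_one_le_of_one_le (one_le_pow₀ (by norm_num)) hC1,
    fun n N hN hnN => ?_⟩
  have hN1 : (1 : ℝ) ≤ N := by exact_mod_cast hN
  let S := (sphere_finite (e + 2) n).toFinset
  let tail : (Fin (e + 2) → ℤ) → (Fin e → ℤ) := fun y i => y i.succ.succ
  let s : ℤ := Nat.sqrt N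
  have hS : ∀ {y}, y ∈ S ↔ y ∈ sphere (e + 2) n := (sphere_finite (e + 2) n).mem_toFinset
  -- Once all but two coordinates are fixed, a sum of two squares is prescribed, leaving `O(N^ε)`
  -- choices.
  have hfib : ∀ t ∈ S.image tail, (S.filter fun y => tail y = t).card ≤ ⌊C * (N : ℝ) ^ ε⌋₊ := by
    intro t _
    refine Nat.le_floor ?_
    have h := hC N hN (n - ∑ i, t i ^ 2) (by
        have : (n : ℤ) ≤ N := by exact_mod_cast hnN
        have : 0 ≤ ∑ i, t i ^ 2 := Finset.sum_nonneg fun i _ => sq_nonneg _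
        linarith)
      ((S.filter fun y => tail y = t).image fun y => (y 0, y 1)) (by
        intro z hz
        obtain ⟨y, hy, rfl⟩ := Finset.mem_image.1 hz
        obtain ⟨hyS, hyt⟩ := Finset.mem_filter.1 hy
        have := mem_sphere.1 (hS.1 hyS)
        rw [Fin.sum_univ_succ, Fin.sum_univ_succ] at this
        rw [← this, ← hyt]
        simp [tail]
        ring)
    rwa [Finset.card_image_of_injOn] at h
    intro y hy y' hy' hyy
    have h1 := (Finset.mem_filter.1 hy).2
    have h2 := (Finset.mem_filter.1 hy').2
    simp only [Prod.mk.injEq] at hyy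
    funext i
    refine Fin.cases hyy.1 (fun j => ?_) i
    refine Fin.cases hyy.2 (fun k => ?_) j
    exact congrFun (h1.trans h2.symm) k
  have himg : (S.image tail).card ≤ (2 * Nat.sqrt N + 1) ^ e := by
    have hsub : S.image tail ⊆ Fintype.piFinset fun _ : Fin e => Finset.Icc (-s) s := by
      intro t ht
      obtain ⟨y, hy, rfl⟩ := Finset.mem_image.1 ht
      rw [Fintype.mem_piFinset]
      intro i
      have h := abs_le_sqrt_of_mem_sphere (hS.1 hy) i.succ.succ
      have h2 : (Nat.sqrt n : ℤ) ≤ Nat.sqrt N := by exact_mod_cast Nat.sqrt_le_sqrt hnN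
      exact Finset.mem_Icc.2 (abs_le.1 (h.trans h2))
    refine (Finset.card_le_card hsub).trans ?_
    rw [Fintype.card_piFinset_const, Int.card_Icc]
    refine le_of_eq ?_
    congr 1
    simp only [s]
    omega
  have hcard : S.card ≤ ⌊C * (N : ℝ) ^ ε⌋₊ * (2 * Nat.sqrt N + 1) ^ e :=
    (Finset.card_le_mul_card_image S _ hfib).trans (Nat.mul_le_mul_left _ himg)
  have hsq : (2 * (Nat.sqrt N : ℝ) + 1) ≤ 3 * (N : ℝ) ^ (1 / 2 : ℝ) := by
    have h1 : (Nat.sqrt N : ℝ) ≤ (N : ℝ) ^ (1 / 2 : ℝ) := by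
      rw [← Real.sqrt_eq_rpow]
      exact Real.nat_sqrt_le_real_sqrt
    have h2 : (1 : ℝ) ≤ (N : ℝ) ^ (1 / 2 : ℝ) := Real.one_le_rpow hN1 (by norm_num)
    linarith
  rw [Set.ncard_eq_toFinset_card _ (sphere_finite (e + 2) n)]
  calc (S.card : ℝ) ≤ ⌊C * (N : ℝ) ^ ε⌋₊ * (2 * (Nat.sqrt N : ℝ) + 1) ^ e := by
        exact_mod_cast hcard
    _ ≤ (C * (N : ℝ) ^ ε) * (3 * (N : ℝ) ^ (1 / 2 : ℝ)) ^ e := by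
        gcongr
        exact Nat.floor_le (by positivity)
    _ = 3 ^ e * C * (N : ℝ) ^ ((e : ℝ) / 2 + ε) := by
        rw [mul_pow, Real.rpow_add (by positivity), ← Real.rpow_natCast ((N : ℝ) ^ (1 / 2 : ℝ)),
          ← Real.rpow_mul (by positivity)]
        rw [show (1 / 2 : ℝ) * e = e / 2 by ring]
        ring

/-- Upper bound for the number of points on a sphere modulo `Q`. -/
theorem exists_card_zmod_sphere_le (e : ℕ) {ε : ℝ} (hε : 0 < ε) :
    ∃ C : ℝ, 1 ≤ C ∧ ∀ (Q : ℕ) [NeZero Q] (l : ZMod Q) (S : Finset (Fin (e + 2) → ZMod Q)),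
      (∀ r ∈ S, ∑ i, r i ^ 2 = l) → (S.card : ℝ) ≤ C * (Q : ℝ) ^ ((e : ℝ) + 1 + ε) := by
  classical
  obtain ⟨C, hC1, hC⟩ := exists_ncard_sphere_le e (half_pos hε)
  let D : ℝ := ((e + 2 : ℕ) : ℝ)
  have hD1 : (1 : ℝ) ≤ D := by simp only [D]; push_cast; linarith [(Nat.cast_nonneg e : (0 : ℝ) ≤ e)]
  have hexp : (0 : ℝ) ≤ (e : ℝ) / 2 + ε / 2 := by positivity
  refine ⟨C * D ^ ((e : ℝ) / 2 + ε / 2) * D,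
    one_le_mul_of_one_le_of_one_le (one_le_mul_of_one_le_of_one_le hC1
      (Real.one_le_rpow hD1 hexp)) hD1, fun Q _ l S hS => ?_⟩
  have hQ : 1 ≤ Q := Nat.one_le_iff_ne_zero.2 (NeZero.ne Q)
  have hQ0 : (0 : ℝ) < Q := by exact_mod_cast hQ
  -- Residues are lifted to `[0, Q)`, so the integer sum of squares stays below `N`. It is fixed mod
  -- `Q`, hence determined by its quotient by `Q`, which takes at most `(e + 2) Q` values; each
  -- value is an integer sphere.
  let N := (e + 2) * Q ^ 2
  have hN : 1 ≤ N := Nat.one_le_iff_ne_zero.2 (by positivity)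
  let v : (Fin (e + 2) → ZMod Q) → ℕ := fun r => ∑ i, (r i).val ^ 2
  have hv : ∀ r, v r < N := by
    intro r
    calc v r < ∑ _i : Fin (e + 2), Q ^ 2 := by
          refine Finset.sum_lt_sum_of_nonempty Finset.univ_nonempty fun i _ => ?_
          exact Nat.pow_lt_pow_left (ZMod.val_lt _) two_ne_zero
      _ = N := by simp [N]
  have hvmod : ∀ r ∈ S, v r % Q = l.val := by
    intro r hr
    rw [← hS r hr, ← ZMod.val_natCast]
    congr 1
    simp [v]
  have hfib : ∀ k ∈ S.image (fun r => v r / Q), (S.filter fun r => v r / Q = k).card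
      ≤ ⌊C * (N : ℝ) ^ ((e : ℝ) / 2 + ε / 2)⌋₊ := by
    intro k hk
    obtain ⟨r₀, hr₀, rfl⟩ := Finset.mem_image.1 hk
    refine Nat.le_floor (le_trans ?_ (hC (v r₀) N hN (hv r₀).le))
    rw [Set.ncard_eq_toFinset_card _ (sphere_finite (e + 2) (v r₀))]
    norm_cast
    refine Finset.card_le_card_of_injOn (fun r i => ((r i).val : ℤ)) ?_ ?_
    · intro r hr
      obtain ⟨hr, hrk⟩ := Finset.mem_filter.1 hr
      have : v r = v r₀ := by
        rw [← Nat.div_add_mod (v r) Q, ← Nat.div_add_mod (v r₀) Q, hvmod r hr, hvmod r₀ hr₀, hrk]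
      rw [Finset.mem_coe, Set.Finite.mem_toFinset, mem_sphere, ← this]
      simp [v]
    · intro r _ r' _ h
      funext i
      have := congrFun h i
      exact ZMod.val_injective Q (Int.ofNat_inj.1 this)
  have himg : (S.image (fun r => v r / Q)).card ≤ (e + 2) * Q := by
    rw [← Finset.card_range ((e + 2) * Q)]
    refine Finset.card_le_card fun k hk => ?_
    obtain ⟨r, _, rfl⟩ := Finset.mem_image.1 hk
    rw [Finset.mem_range, Nat.div_lt_iff_lt_mul (by omega)]
    have := hv r
    simp only [N] at this
    linarith
  have hcard := (Finset.card_le_mul_card_image S _ hfib).trans (Nat.mul_le_mul_left _ himg)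
  calc (S.card : ℝ) ≤ ⌊C * (N : ℝ) ^ ((e : ℝ) / 2 + ε / 2)⌋₊ * (D * Q) := by
        simp only [D]
        exact_mod_cast hcard
    _ ≤ (C * (N : ℝ) ^ ((e : ℝ) / 2 + ε / 2)) * (D * Q) := by
        gcongr
        exact Nat.floor_le (by positivity)
    _ = _ := by
        have h1 : (N : ℝ) = D * (Q : ℝ) ^ (2 : ℝ) := by simp [N, D]
        rw [h1, Real.mul_rpow (by positivity) (by positivity), ← Real.rpow_mul hQ0.le,
          show (e : ℝ) + 1 + ε = 2 * ((e : ℝ) / 2 + ε / 2) + 1 by ring,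
          Real.rpow_add hQ0, Real.rpow_one]
        ring

/-- Lagrange's four-square theorem, padded with zeros; this is where `d ≥ 4` enters. -/
theorem sphere_nonempty {d : ℕ} (hd : 4 ≤ d) (n : ℕ) : (sphere d n).Nonempty := by
  obtain ⟨e, rfl⟩ := Nat.exists_eq_add_of_le' hd
  obtain ⟨a, b, c, k, h⟩ := Nat.sum_four_squares n
  refine ⟨Fin.cons a (Fin.cons b (Fin.cons c (Fin.cons k 0))), ?_⟩
  rw [mem_sphere]
  simp only [Fin.sum_univ_succ, Fin.cons_zero, Fin.cons_succ, Pi.zero_apply]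
  rw [← h]
  push_cast
  simp
  ring

theorem ncard_sphere_pos {d : ℕ} (hd : 4 ≤ d) (n : ℕ) : 0 < (sphere d n).ncard :=
  (Set.ncard_pos (sphere_finite d n)).2 (sphere_nonempty hd n)

/-! ### Testing the maximal operator on indicator functions. -/

theorem sum_comp_le_tsum_of_injOn {α β : Type*} {I : Finset α} {g : α → β}
    (hg : Set.InjOn g I) (F : β → ℝ≥0∞) : ∑ t ∈ I, F (g t) ≤ ∑' x, F x := by
  classical
  rw [← Finset.sum_image hg]
  exact ENNReal.sum_le_tsum _

/-- Boundedness of the maximal operator, tested on the indicator of a finite set. -/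
theorem IsBoundedMaximal.exists_tsum_le {d : ℕ} {Λ : Set ℕ} {p : ℝ} (hp : 0 < p)
    (h : IsBoundedMaximal d Λ p) : ∃ C : ℝ, 0 ≤ C ∧ ∀ T : Finset (Fin d → ℤ),
      ∑' x, maximalFn Λ (fun x => if x ∈ T then 1 else 0) x ^ p ≤ ENNReal.ofReal C * T.card := by
  classical
  obtain ⟨C, hC⟩ := h
  refine ⟨(C : ℝ) ^ p, by positivity, fun T => ?_⟩
  have hf : Memℓp (fun x => if x ∈ T then (1 : ℂ) else 0) (ENNReal.ofReal p) := by
    refine memℓp_gen ?_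
    rw [ENNReal.toReal_ofReal hp.le]
    refine summable_of_ne_finset_zero (s := T) fun x hx => ?_
    simp [hx, hp.ne']
  have h1 := ENNReal.rpow_le_rpow (hC _ hf) hp.le
  have h2 : ∑' x : Fin d → ℤ, ‖(if x ∈ T then (1 : ℂ) else 0)‖ₑ ^ p = T.card := by
    rw [tsum_eq_sum (s := T) fun x hx => by simp [hx, hp]]
    rw [Finset.sum_congr rfl (g := fun _ => 1) fun x hx => by simp [hx]]
    simp
  rw [ENNReal.mul_rpow_of_nonneg _ _ hp.le] at h1
  simp only [ellNorm] at h1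
  rw [← ENNReal.rpow_mul, ← ENNReal.rpow_mul, one_div_mul_cancel hp.ne', ENNReal.rpow_one,
    ENNReal.rpow_one, h2] at h1
  rwa [← ENNReal.ofReal_rpow_of_nonneg C.coe_nonneg hp.le, ENNReal.ofReal_coe_nnreal]

theorem enorm_avg_le_maximalFn {d : ℕ} {Λ : Set ℕ} {n : ℕ} (hn : n ∈ Λ) (f : (Fin d → ℤ) → ℂ)
    (x : Fin d → ℤ) : ‖avg n f x‖ₑ ≤ maximalFn Λ f x :=
  le_iSup₂ (f := fun n (_ : n ∈ Λ) => ‖avg n f x‖ₑ) n hn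

theorem enorm_avg_indicator {d n : ℕ} [DecidableEq (Fin d → ℤ)] (T : Finset (Fin d → ℤ))
    (x : Fin d → ℤ) (hn : 0 < (sphere d n).ncard) :
    ‖avg n (fun x => if x ∈ T then 1 else 0) x‖ₑ
      = (((sphere_finite d n).toFinset.filter fun y => x - y ∈ T).card : ℝ≥0∞)
        / (sphere d n).ncard := by
  rw [avg, Finset.sum_boole, enorm_eq_nnnorm, nnnorm_div, ENNReal.coe_div (by simpa using hn.ne')]
  simp

/-- Testing the maximal operator on a point mass. -/
theorem IsBoundedMaximal.exists_sum_ncard_rpow_le {d : ℕ} (hd : 4 ≤ d) {Λ : Set ℕ} {p : ℝ}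
    (hp : 0 < p) (h : IsBoundedMaximal d Λ p) : ∃ C : ℝ, 0 ≤ C ∧ ∀ F : Finset ℕ, (F : Set ℕ) ⊆ Λ →
      ∑ n ∈ F, ((sphere d n).ncard : ℝ) ^ (1 - p) ≤ C := by
  classical
  obtain ⟨C, hC0, hC⟩ := h.exists_tsum_le hp
  refine ⟨C, hC0, fun F hF => ?_⟩
  have h1 := hC {0}
  simp only [Finset.card_singleton, Nat.cast_one, mul_one] at h1
  rw [← ENNReal.ofReal_le_ofReal_iff hC0]
  refine le_trans ?_ h1
  have hdisj : (F : Set ℕ).PairwiseDisjoint fun n => (sphere_finite d n).toFinset := by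
    intro n _ m _ hnm
    refine Finset.disjoint_left.2 fun x hx hx' => hnm ?_
    rw [Set.Finite.mem_toFinset, mem_sphere] at hx hx'
    exact_mod_cast hx.symm.trans hx'
  calc ENNReal.ofReal (∑ n ∈ F, ((sphere d n).ncard : ℝ) ^ (1 - p))
      = ∑ n ∈ F, ∑ x ∈ (sphere_finite d n).toFinset, (1 / ((sphere d n).ncard : ℝ≥0∞)) ^ p := by
        rw [ENNReal.ofReal_sum_of_nonneg fun n _ => by positivity]
        refine Finset.sum_congr rfl fun n _ => ?_
        have hn := ncard_sphere_pos hd n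
        have hn' : (0 : ℝ) < (sphere d n).ncard := by exact_mod_cast hn
        have hn0 : ((sphere d n).ncard : ℝ≥0∞) ≠ 0 := by exact_mod_cast hn.ne'
        rw [Finset.sum_const, ← Set.ncard_eq_toFinset_card _ (sphere_finite d n), nsmul_eq_mul,
          ← ENNReal.ofReal_rpow_of_pos hn', ENNReal.ofReal_natCast, one_div, ENNReal.inv_rpow,
          ← ENNReal.rpow_neg, sub_eq_add_neg, ENNReal.rpow_add _ _ hn0 (ENNReal.natCast_ne_top _),
          ENNReal.rpow_one]
    _ ≤ ∑ n ∈ F, ∑ x ∈ (sphere_finite d n).toFinset,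
          maximalFn Λ (fun x => if x ∈ ({0} : Finset (Fin d → ℤ)) then 1 else 0) x ^ p := by
        refine Finset.sum_le_sum fun n hn => Finset.sum_le_sum fun x hx => ?_
        refine ENNReal.rpow_le_rpow (le_trans ?_ (enorm_avg_le_maximalFn (hF hn) _ x)) hp.le
        rw [enorm_avg_indicator _ _ (ncard_sphere_pos hd n)]
        refine ENNReal.div_le_div_right ?_ _
        have : 0 < ((sphere_finite d n).toFinset.filter
            fun y => x - y ∈ ({0} : Finset (Fin d → ℤ))).card :=
          Finset.card_pos.2 ⟨x, by simpa using hx⟩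
        exact_mod_cast this
    _ = ∑ x ∈ F.biUnion fun n => (sphere_finite d n).toFinset, _ := (Finset.sum_biUnion hdisj).symm
    _ ≤ _ := ENNReal.sum_le_tsum _

/-- Testing the maximal operator on a large piece of the lattice `Q ℤ^d`: if `F ⊆ Λ` consists of
integers that are distinct modulo `Q`, then the size of `F` is controlled by the size of the
spheres modulo `Q`. -/
theorem IsBoundedMaximal.exists_card_le {d : ℕ} (hd : 4 ≤ d) {Λ : Set ℕ} {p : ℝ}
    (hp : 1 ≤ p) (h : IsBoundedMaximal d Λ p) : ∃ C : ℝ, 0 ≤ C ∧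
      ∀ (Q : ℕ) [NeZero Q] (F : Finset ℕ) (K : ℝ), (F : Set ℕ) ⊆ Λ →
      Set.InjOn (fun n : ℕ => (n : ZMod Q)) F → 0 ≤ K →
      (∀ l : ZMod Q, ((Finset.univ.filter
        fun r : Fin d → ZMod Q => ∑ i, r i ^ 2 = l).card : ℝ) ≤ K) →
      (F.card : ℝ) ≤ K ^ (p - 1) * C := by
  classical
  have hp0 : 0 < p := by linarith
  obtain ⟨C, hC0, hC⟩ := h.exists_tsum_le hp0
  refine ⟨3 ^ d * C, by positivity, fun Q _ F K hF hinj hK0 hK => ?_⟩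
  have hQ : (1 : ℤ) ≤ Q := by exact_mod_cast Nat.one_le_iff_ne_zero.2 (NeZero.ne Q)
  let L : ℕ := F.sup Nat.sqrt
  have hL : ∀ n ∈ F, ∀ y ∈ sphere d n, ∀ i, |y i| ≤ L := fun n hn y hy i =>
    (abs_le_sqrt_of_mem_sphere hy i).trans (by exact_mod_cast Finset.le_sup (f := Nat.sqrt) hn)
  let box : ℕ → Finset (Fin d → ℤ) := fun R =>
    Fintype.piFinset fun _ => Finset.Icc (-(R : ℤ)) R
  have hbox : ∀ R, (box R).card = (2 * R + 1) ^ d := by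
    intro R
    simp only [box]
    rw [Fintype.card_piFinset_const, Int.card_Icc]
    congr 1
    omega
  -- If `Qz + r - y = Qw` with `z`, `y` in the box of radius `L` and `0 ≤ r < Q` coordinatewise,
  -- then `w` lies in the box of radius `2L + 1`. So `T` has no boundary effect at the points `pt z
  -- r`.
  let T : Finset (Fin d → ℤ) := (box (2 * L + 1)).image fun z i => Q * z i
  let red : (Fin d → ℤ) → Fin d → ZMod Q := fun y i => (y i : ZMod Q)
  let pt : (Fin d → ℤ) → (Fin d → ZMod Q) → Fin d → ℤ := fun z r i => Q * z i + (r i).val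
  have hval : ∀ r : Fin d → ZMod Q, ∀ i, 0 ≤ ((r i).val : ℤ) ∧ ((r i).val : ℤ) < Q := fun r i =>
    ⟨Nat.cast_nonneg _, by exact_mod_cast ZMod.val_lt (r i)⟩
  have hpt : ∀ z r, red (pt z r) = r := by
    intro z r
    funext i
    simp [red, pt]
  let μ : ℕ → (Fin d → ZMod Q) → ℝ≥0∞ := fun n r =>
    (((sphere_finite d n).toFinset.filter fun y => red y = r).card : ℝ≥0∞) / (sphere d n).ncard
  have hμ : ∀ n ∈ F, ∀ z ∈ box L, ∀ r, μ n r ≤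
      maximalFn Λ (fun x => if x ∈ T then 1 else 0) (pt z r) := by
    intro n hn z hz r
    refine le_trans ?_ (enorm_avg_le_maximalFn (hF hn) _ _)
    rw [enorm_avg_indicator _ _ (ncard_sphere_pos hd n)]
    refine ENNReal.div_le_div_right ?_ _
    norm_cast
    refine Finset.card_le_card fun y hy => ?_
    obtain ⟨hyS, rfl⟩ := Finset.mem_filter.1 hy
    refine Finset.mem_filter.2 ⟨hyS, ?_⟩
    have hdvd : ∀ i, (Q : ℤ) ∣ (pt z (red y) - y) i := by
      intro i
      rw [← ZMod.intCast_zmod_eq_zero_iff_dvd]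
      simp [pt, red]
    choose w hw using hdvd
    refine Finset.mem_image.2 ⟨w, ?_, funext fun i => (hw i).symm⟩
    rw [Fintype.mem_piFinset]
    intro i
    have hz' := Finset.mem_Icc.1 (Fintype.mem_piFinset.1 hz i)
    have hy' := abs_le.1 (hL n hn y ((sphere_finite d n).mem_toFinset.1 hyS) i)
    have hv := hval (red y) i
    have hwi := hw i
    simp only [pt, Pi.sub_apply] at hwi
    have hL0 : (0 : ℤ) ≤ L := Nat.cast_nonneg _
    rw [Finset.mem_Icc]
    push_cast
    constructor
    · by_contra hlt
      have : (Q : ℤ) * w i ≤ Q * (-(2 * L + 1) - 1) :=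
        mul_le_mul_of_nonneg_left (by omega) (by omega)
      nlinarith
    · by_contra hlt
      have : (Q : ℤ) * ((2 * L + 1) + 1) ≤ Q * w i :=
        mul_le_mul_of_nonneg_left (by omega) (by omega)
      nlinarith
  let lev : ℕ → Finset (Fin d → ZMod Q) := fun n =>
    Finset.univ.filter fun r : Fin d → ZMod Q => ∑ i, r i ^ 2 = (n : ZMod Q)
  have hmass : ∀ n, ∑ r ∈ lev n, μ n r = 1 := by
    intro n
    have hn := ncard_sphere_pos hd n
    have hmaps : ∀ y ∈ (sphere_finite d n).toFinset, red y ∈ lev n := by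
      intro y hy
      have := mem_sphere.1 ((sphere_finite d n).mem_toFinset.1 hy)
      refine Finset.mem_filter.2 ⟨Finset.mem_univ _, ?_⟩
      have := congrArg (Int.cast : ℤ → ZMod Q) this
      push_cast at this
      exact this
    have := Finset.card_eq_sum_card_fiberwise hmaps
    rw [← Set.ncard_eq_toFinset_card _ (sphere_finite d n)] at this
    simp only [μ, ENNReal.div_eq_inv_mul]
    rw [← Finset.mul_sum, ← Nat.cast_sum, ← this]
    exact ENNReal.inv_mul_cancel (by exact_mod_cast hn.ne') (ENNReal.natCast_ne_top _)
  -- Power-mean inequality for a probability vector supported on at most `K` residues.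
  have hholder : ∀ n, 1 ≤ ENNReal.ofReal (K ^ (p - 1)) * ∑ r ∈ lev n, μ n r ^ p := by
    intro n
    have h1 := ENNReal.rpow_sum_le_const_mul_sum_rpow (lev n) (μ n) hp
    rw [hmass, ENNReal.one_rpow] at h1
    refine h1.trans (mul_le_mul_left ?_ _)
    rw [← ENNReal.ofReal_rpow_of_nonneg hK0 (by linarith)]
    refine ENNReal.rpow_le_rpow ?_ (by linarith)
    rw [← ENNReal.ofReal_natCast]
    exact ENNReal.ofReal_le_ofReal (hK _)
  let I : Finset ((Fin d → ℤ) × (Σ _ : ℕ, Fin d → ZMod Q)) := box L ×ˢ F.sigma lev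
  -- The point determines `r`, then `|r|²` determines `n` because `F` is injective mod `Q`, and `z`
  -- follows.
  have hIinj : Set.InjOn (fun t : (Fin d → ℤ) × (Σ _ : ℕ, Fin d → ZMod Q) => pt t.1 t.2.2) I := by
    rintro ⟨z, n, r⟩ ht ⟨z', n', r'⟩ ht' heq
    simp only [I, Finset.coe_product, Set.mem_prod, Finset.mem_coe, Finset.mem_sigma, lev,
      Finset.mem_filter, Finset.mem_univ, true_and] at ht ht' heq
    have hr : r = r' := by rw [← hpt z r, heq, hpt]
    subst hr
    have hn : n = n' := hinj ht.2.1 ht'.2.1 (ht.2.2.symm.trans ht'.2.2)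
    subst hn
    have hz : z = z' := by
      funext i
      have := congrFun heq i
      simp only [pt, add_left_inj] at this
      exact mul_left_cancel₀ (by omega) this
    rw [hz]
  have hmain : (∑ t ∈ I, μ t.2.1 t.2.2 ^ p) ≤ ENNReal.ofReal C * T.card := by
    refine le_trans ?_ (hC T)
    calc ∑ t ∈ I, μ t.2.1 t.2.2 ^ p
        ≤ ∑ t ∈ I, maximalFn Λ (fun x => if x ∈ T then 1 else 0) (pt t.1 t.2.2) ^ p := by
          refine Finset.sum_le_sum fun t ht => ENNReal.rpow_le_rpow ?_ hp0.le
          obtain ⟨h1, h2⟩ := Finset.mem_product.1 ht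
          exact hμ _ (Finset.mem_sigma.1 h2).1 _ h1 _
      _ ≤ _ := sum_comp_le_tsum_of_injOn hIinj _
  have hlow : ((2 * L + 1) ^ d : ℕ) * (F.card : ℝ≥0∞)
      ≤ ENNReal.ofReal (K ^ (p - 1)) * ∑ t ∈ I, μ t.2.1 t.2.2 ^ p := by
    rw [Finset.sum_product]
    dsimp only
    rw [Finset.sum_const, hbox, nsmul_eq_mul, mul_left_comm]
    refine mul_le_mul_right ?_ _
    rw [Finset.sum_sigma, Finset.mul_sum, Finset.card_eq_sum_ones]
    push_cast
    exact Finset.sum_le_sum fun n _ => hholder n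
  -- The two boxes have comparable size, so the dependence on `L` cancels and `C` is uniform in `Q`
  -- and `F`.
  have hT : T.card ≤ 3 ^ d * (2 * L + 1) ^ d := by
    refine Finset.card_image_le.trans ?_
    rw [hbox, ← mul_pow]
    exact Nat.pow_le_pow_left (by omega) _
  have hfin : ((2 * L + 1) ^ d : ℕ) * (F.card : ℝ≥0∞)
      ≤ ENNReal.ofReal (K ^ (p - 1)) * (ENNReal.ofReal C * (3 ^ d * (2 * L + 1) ^ d : ℕ)) := by
    refine hlow.trans (mul_le_mul_right (hmain.trans (mul_le_mul_right ?_ _)) _)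
    exact_mod_cast hT
  have hfin' : ((2 * L + 1) ^ d : ℕ) * (F.card : ℝ)
      ≤ K ^ (p - 1) * (C * (3 ^ d * (2 * L + 1) ^ d : ℕ)) := by
    rw [← ENNReal.ofReal_le_ofReal_iff (by positivity), ENNReal.ofReal_mul (by positivity),
      ENNReal.ofReal_mul (by positivity), ENNReal.ofReal_mul (by positivity),
      ENNReal.ofReal_natCast, ENNReal.ofReal_natCast, ENNReal.ofReal_natCast]
    exact hfin
  have hpos : (0 : ℝ) < ((2 * L + 1) ^ d : ℕ) := by positivity
  refine le_of_mul_le_mul_left (hfin'.trans (le_of_eq ?_)) hpos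
  push_cast
  ring

/-! ### From the test inequalities to bounds on the dimensions. -/

theorem le_mul_of_forall_pos_le_mul_add {x a b : ℝ} (hb : 0 ≤ b)
    (h : ∀ ε : ℝ, 0 < ε → x ≤ b * (a + ε)) : x ≤ b * a := by
  refine le_of_forall_pos_le_add fun δ hδ => ?_
  have hb1 : 0 < b + 1 := by linarith
  have h1 := h (δ / (b + 1)) (by positivity)
  have h2 : (b + 1) * (δ / (b + 1)) = δ := by field_simp
  have h3 : 0 < δ / (b + 1) := by positivity
  nlinarith

theorem IsBoundedMaximal.growthExp_le {e : ℕ} (hd : 4 ≤ e + 2) {Λ : Set ℕ} {p : ℝ} (hp : 1 ≤ p)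
    (h : IsBoundedMaximal (e + 2) Λ p) : growthExp Λ ≤ (p - 1) * ((e : ℝ) / 2) := by
  have hp0 : 0 ≤ p - 1 := by linarith
  refine le_mul_of_forall_pos_le_mul_add hp0 fun ε hε => ?_
  obtain ⟨C, hC0, hC⟩ := h.exists_sum_ncard_rpow_le hd (by linarith)
  obtain ⟨D, hD1, hD⟩ := exists_ncard_sphere_le e hε
  refine csInf_le ⟨0, fun δ hδ => hδ.1⟩
    ⟨by positivity, C * (D * 2 ^ ((e : ℝ) / 2 + ε)) ^ (p - 1), fun N hN => ?_⟩
  have hN0 : (0 : ℝ) < N := by exact_mod_cast hN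
  have hfin : (Λ ∩ Set.Icc N (2 * N)).Finite := (Set.finite_Icc _ _).subset Set.inter_subset_right
  have h1 := hC hfin.toFinset (by simp)
  -- A bound for all spheres with `n ≤ 2N`; since `1 - p ≤ 0`, it bounds each term of the sum from
  -- below.
  let M : ℝ := D * ((2 * N : ℕ) : ℝ) ^ ((e : ℝ) / 2 + ε)
  have hM : 0 < M := by positivity
  have h2 : ∀ n ∈ hfin.toFinset, M ^ (1 - p) ≤ ((sphere (e + 2) n).ncard : ℝ) ^ (1 - p) := by
    intro n hn
    have hn' := (hfin.mem_toFinset.1 hn).2.2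
    exact Real.rpow_le_rpow_of_nonpos (by exact_mod_cast ncard_sphere_pos hd n)
      (hD n (2 * N) (by omega) hn') (by linarith)
  have h3 := (Finset.card_nsmul_le_sum _ _ _ h2).trans h1
  rw [nsmul_eq_mul, ← Set.ncard_eq_toFinset_card _ hfin, show 1 - p = -(p - 1) by ring,
    Real.rpow_neg hM.le, ← div_eq_mul_inv, div_le_iff₀ (by positivity)] at h3
  refine h3.trans (le_of_eq ?_)
  simp only [M]
  push_cast
  rw [Real.mul_rpow two_pos.le hN0.le, ← mul_assoc, Real.mul_rpow (by positivity) (by positivity),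
    ← Real.rpow_mul hN0.le, mul_assoc]
  ring_nf

/-- One representative of each residue class mod `q^k` met by `Λ` gives centres for balls of radius
`q^(-k)`. -/
theorem exists_finset_coveringNumber_le_card (q : ℕ) [Fact q.Prime] (Λ : Set ℕ) (k : ℕ) :
    ∃ F : Finset ℕ, (F : Set ℕ) ⊆ Λ ∧ Set.InjOn (fun n : ℕ => (n : ZMod (q ^ k))) F ∧
      ∀ ε : ℝ≥0, ((q : ℝ) ^ k)⁻¹ ≤ ε →
        Metric.coveringNumber ε ((fun n : ℕ => (n : ℤ_[q])) '' Λ) ≤ F.card := by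
  classical
  have : NeZero (q ^ k) := ⟨pow_ne_zero _ (Fact.out : q.Prime).ne_zero⟩
  obtain ⟨s, hsΛ, hs⟩ := (Set.surjOn_image (fun n : ℕ => (n : ZMod (q ^ k))) Λ).exists_bijOn_subset
  have hfin : s.Finite := Set.Finite.of_finite_image (Set.toFinite _) hs.injOn
  refine ⟨hfin.toFinset, by simpa using hsΛ, by simpa using hs.injOn, fun ε hε => ?_⟩
  have hcover : Metric.IsCover ε ((fun n : ℕ => (n : ℤ_[q])) '' Λ)
      ((fun n : ℕ => (n : ℤ_[q])) '' s) := by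
    rintro _ ⟨n, hn, rfl⟩
    obtain ⟨m, hm, hmn⟩ := hs.surjOn ⟨n, hn, rfl⟩
    refine ⟨(m : ℤ_[q]), ⟨m, hm, rfl⟩, ?_⟩
    have hdvd : ((q : ℤ) ^ k) ∣ (n : ℤ) - m := by
      have h1 : (((n : ℤ) - m : ℤ) : ZMod (q ^ k)) = 0 := by
        push_cast
        simpa [sub_eq_zero] using hmn.symm
      have := (ZMod.intCast_zmod_eq_zero_iff_dvd _ _).1 h1
      exact_mod_cast this
    have h2 := (PadicInt.norm_int_le_pow_iff_dvd (p := q)).2 hdvd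
    have h3 : dist (n : ℤ_[q]) (m : ℤ_[q]) ≤ ε := by
      rw [dist_eq_norm]
      refine le_trans ?_ hε
      rw [zpow_neg, zpow_natCast] at h2
      exact_mod_cast h2
    show edist (n : ℤ_[q]) (m : ℤ_[q]) ≤ ε
    rw [edist_dist]
    exact ENNReal.ofReal_le_of_le_toReal (by simpa using h3)
  refine (hcover.coveringNumber_le_encard (Set.image_mono hsΛ)).trans
    ((Set.encard_image_le _ _).trans ?_)
  rw [hfin.encard_eq_coe_toFinset_card]

/-- A power bound on the covering numbers along the scales `q ^ (-k)` bounds the dimension. -/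
theorem padicDim_le_of_forall_card_le (q : ℕ) [Fact q.Prime] (Λ : Set ℕ) {A σ : ℝ} (hA : 1 ≤ A)
    (hσ : 0 ≤ σ) (h : ∀ k : ℕ, ∀ F : Finset ℕ, (F : Set ℕ) ⊆ Λ →
      Set.InjOn (fun n : ℕ => (n : ZMod (q ^ k))) F → (F.card : ℝ) ≤ A * ((q : ℝ) ^ k) ^ σ) :
    padicDim q Λ ≤ σ := by
  have hq1 : (1 : ℝ) < q := by exact_mod_cast (Fact.out : q.Prime).one_lt
  have hq0 : (0 : ℝ) < q := by linarith
  refine le_of_forall_pos_le_add fun τ hτ => ?_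
  have hqσ : (1 : ℝ) ≤ (q : ℝ) ^ σ := Real.one_le_rpow hq1.le hσ
  have hA' : 1 ≤ A * (q : ℝ) ^ σ := one_le_mul_of_one_le_of_one_le hA hqσ
  -- Below this radius the constant `log (A q^σ)` is at most `τ log (1/ε)`.
  let b : ℝ≥0 := Real.toNNReal (Real.exp (-(Real.log (A * (q : ℝ) ^ σ) / τ)))
  have hb : 0 < b := Real.toNNReal_pos.2 (Real.exp_pos _)
  have hmem : Set.Ioo (0 : ℝ≥0) (min 1 b) ∈ 𝓝[>] (0 : ℝ≥0) :=
    Ioo_mem_nhdsGT (lt_min one_pos hb)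
  refine limsup_le_of_le (isCoboundedUnder_le_of_eventually_le (x := 0) _ ?_) ?_
  · filter_upwards [hmem] with ε hε
    refine div_nonneg (Real.log_natCast_nonneg _) (Real.log_nonneg ?_)
    rw [one_le_div (by exact_mod_cast hε.1)]
    exact_mod_cast (hε.2.trans_le (min_le_left _ _)).le
  · filter_upwards [hmem] with ε hε
    have hε0 : (0 : ℝ) < ε := by exact_mod_cast hε.1
    have hε1 : (ε : ℝ) < 1 := by exact_mod_cast hε.2.trans_le (min_le_left _ _)
    have hεb : (ε : ℝ) ≤ Real.exp (-(Real.log (A * (q : ℝ) ^ σ) / τ)) := by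
      have : ε ≤ b := (hε.2.trans_le (min_le_right _ _)).le
      exact (Real.le_toNNReal_iff_coe_le (Real.exp_pos _).le).1 this
    have hx1 : 1 < 1 / (ε : ℝ) := (one_lt_div hε0).2 hε1
    have hx0 : 0 < 1 / (ε : ℝ) := by positivity
    have hlog : 0 < Real.log (1 / (ε : ℝ)) := Real.log_pos hx1
    -- Rounding to `q^j ≤ 1/ε < q^(j+1)` costs the factor `q^σ`.
    obtain ⟨j, hj1, hj2⟩ := exists_nat_pow_near hx1.le hq1
    obtain ⟨F, hF, hFinj, hcov⟩ := exists_finset_coveringNumber_le_card q Λ (j + 1)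
    have h1 := hcov ε (by
      rw [inv_le_comm₀ (by positivity) hε0, ← one_div]
      exact hj2.le)
    have h2 := h (j + 1) F hF hFinj
    set n := (Metric.coveringNumber ε ((fun n : ℕ => (n : ℤ_[q])) '' Λ)).toNat with hn
    have h3 : n ≤ F.card := ENat.toNat_le_of_le_natCast h1
    have h4 : (n : ℝ) ≤ A * (q : ℝ) ^ σ * (1 / (ε : ℝ)) ^ σ := by
      calc (n : ℝ) ≤ F.card := by exact_mod_cast h3
        _ ≤ A * ((q : ℝ) ^ (j + 1)) ^ σ := h2
        _ ≤ A * (q * (1 / (ε : ℝ))) ^ σ := by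
            gcongr
            rw [pow_succ']
            gcongr
        _ = _ := by rw [Real.mul_rpow hq0.le hx0.le, mul_assoc]
    have h5 : Real.log n ≤ Real.log (A * (q : ℝ) ^ σ) + σ * Real.log (1 / (ε : ℝ)) := by
      -- A zero covering number is harmless, since `Real.log 0 = 0`.
      rcases Nat.eq_zero_or_pos n with h0 | hpos
      · rw [h0, Nat.cast_zero, Real.log_zero]
        exact add_nonneg (Real.log_nonneg hA') (mul_nonneg hσ hlog.le)
      · refine (Real.log_le_log (by exact_mod_cast hpos) h4).trans (le_of_eq ?_)
        rw [Real.log_mul (by positivity) (by positivity), Real.log_rpow hx0]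
    have h6 : Real.log (A * (q : ℝ) ^ σ) ≤ τ * Real.log (1 / (ε : ℝ)) := by
      have := (Real.log_le_iff_le_exp hε0).2 hεb
      rw [one_div, Real.log_inv]
      have h7 : Real.log (A * (q : ℝ) ^ σ) / τ ≤ -Real.log ε := by linarith
      rw [div_le_iff₀ hτ] at h7
      linarith
    rw [div_le_iff₀ hlog]
    linarith

theorem IsBoundedMaximal.padicDim_le {e : ℕ} (hd : 4 ≤ e + 2) {Λ : Set ℕ} {p : ℝ} (hp : 1 ≤ p)
    (h : IsBoundedMaximal (e + 2) Λ p) (q : ℕ) [Fact q.Prime] :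
    padicDim q Λ ≤ (p - 1) * ((e : ℝ) + 1) := by
  have hp0 : 0 ≤ p - 1 := by linarith
  refine le_mul_of_forall_pos_le_mul_add hp0 fun ε hε => ?_
  obtain ⟨C, hC0, hC⟩ := h.exists_card_le hd hp
  obtain ⟨D, hD1, hD⟩ := exists_card_zmod_sphere_le e hε
  -- The maximum with 1 keeps the logarithm of the constant nonnegative.
  refine padicDim_le_of_forall_card_le q Λ (A := max 1 (D ^ (p - 1) * C)) (le_max_left _ _)
    (by positivity) fun k F hF hinj => ?_
  have : NeZero (q ^ k) := ⟨pow_ne_zero _ (Fact.out : q.Prime).ne_zero⟩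
  have h1 := hC (q ^ k) F (D * ((q ^ k : ℕ) : ℝ) ^ ((e : ℝ) + 1 + ε)) hF hinj (by positivity)
    fun l => hD (q ^ k) l _ fun r hr => (Finset.mem_filter.1 hr).2
  refine h1.trans ?_
  push_cast
  rw [Real.mul_rpow (by positivity) (by positivity), ← Real.rpow_mul (by positivity),
    mul_right_comm, mul_comm ((e : ℝ) + 1 + ε)]
  gcongr
  exact le_max_right _ _

theorem IsBoundedMaximal.eta_le {d : ℕ} (hd : 4 ≤ d) {Λ : Set ℕ} {p : ℝ} (hp : 1 ≤ p)
    (h : IsBoundedMaximal d Λ p) : eta d Λ ≤ p := by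
  obtain ⟨e, rfl⟩ : ∃ e, d = e + 2 := ⟨d - 2, by omega⟩
  have he : (2 : ℝ) ≤ e := by exact_mod_cast (by omega : 2 ≤ e)
  have : Nonempty Nat.Primes := ⟨⟨2, Nat.prime_two⟩⟩
  refine max_le (ciSup_le fun q => ?_) ?_
  · have : Fact (q : ℕ).Prime := ⟨q.2⟩
    have h1 := h.padicDim_le hd hp (q : ℕ)
    have h2 : padicDim (q : ℕ) Λ / (((e + 2 : ℕ) : ℝ) - 1) ≤ p - 1 := by
      rw [div_le_iff₀ (by push_cast; linarith)]
      push_cast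
      linarith
    linarith
  · have h1 := h.growthExp_le hd hp
    have h2 : 2 * growthExp Λ / (((e + 2 : ℕ) : ℝ) - 2) ≤ p - 1 := by
      rw [div_le_iff₀ (by push_cast; linarith)]
      push_cast
      linarith
    linarith

theorem not_isBoundedMaximal_of_infinite {d : ℕ} (hd : 4 ≤ d) {Λ : Set ℕ} (hΛ : Λ.Infinite)
    {p : ℝ} (hp0 : 0 < p) (hp : p ≤ 1) : ¬ IsBoundedMaximal d Λ p := by
  intro h
  obtain ⟨C, _, hC⟩ := h.exists_sum_ncard_rpow_le hd hp0
  obtain ⟨F, hF, hcard⟩ := hΛ.exists_subset_card_eq (⌊C⌋₊ + 1)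
  have h1 : ∀ n ∈ F, (1 : ℝ) ≤ ((sphere d n).ncard : ℝ) ^ (1 - p) := fun n _ =>
    Real.one_le_rpow (by exact_mod_cast ncard_sphere_pos hd n) (by linarith)
  have h2 := (Finset.card_nsmul_le_sum F _ 1 h1).trans (hC F hF)
  rw [hcard, nsmul_eq_mul, mul_one] at h2
  push_cast at h2
  linarith [Nat.lt_floor_add_one C]

end ArithSphere

theorem theorem1 (d : ℕ) (hd : 4 ≤ d) (Λ : Set ℕ) (p : ℝ) (hp0 : 0 < p)
    (hp1 : 1 ≤ p ∨ Λ.Infinite) (hp : p < ArithSphere.eta d Λ) :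
    ¬ ArithSphere.IsBoundedMaximal d Λ p := by
  rcases le_or_gt 1 p with h1 | h1
  · exact fun h => (h.eta_le hd h1).not_gt hp
  · exact ArithSphere.not_isBoundedMaximal_of_infinite hd (hp1.resolve_left h1.not_ge) hp0 h1.le
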